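/- All monoids, groups and semigroups are finite. A pseudovariety of monoids (of groups) is a class of finite monoids (finite groups) closed under finite direct products, submonoids (subgroups) and homomorphic images. A pseudovariety $\mathbf H$ of groups is \emph{Fitting} if, whenever $A,B\trianglelefteq G$ are normal subgroups of a finite group $G$ with $A,B\in\mathbf H$, also $AB\in\mathbf H$. Let $\mathbf{LH}$ be the class of all finite semigroups $S$ such that for every idempotent $e\in S$ the local monoid $eSe$ is a group belonging to $\mathbf H$. An $\mathbf{LH}$-morphism of monoids is a surjective homomorphism $\varphi:M\to N$ such that $\varphi^{-1}(e)\in\mathbf{LH}$ for every idempotent $e\in N$. For a pseudovariety $\mathbf V$ of monoids, the Mal'cev product $\mathbf{LH}\,\mathbin{\bigcirc\!\!\!\!\mathrm{m}}\,\mathbf V$ is the pseudovariety of monoids generated by all finite monoids $M$ that admit a homomorphism $\varphi:M\to N$ with $N\in\mathbf V$ and $\varphi^{-1}(e)\in\mathbf{LH}$ for every idempotent $e\in N$. A pseudovariety is \emph{decidable} if there is an algorithm which, given a finite multiplication table, decides whether it is the table of a member of the pseudovariety. Corollary. Let $\mathbf H$ be a Fitting pseudovariety of groups and let $\mathbf V$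 be a pseudovariety of monoids. Then a finite monoid $M$ belongs to $\mathbf{LH}\,\mathbin{\bigcirc\!\!\!\!\mathrm{m}}\,\mathbf V$ if and only if there is an $\mathbf{LH}$-morphism from $M$ to some monoid in $\mathbf V$. In particular, if $\mathbf H$ and $\mathbf V$ are decidable, then so is $\mathbf{LH}\,\mathbin{\bigcirc\!\!\!\!\mathrm{m}}\,\mathbf V$. -/

import Mathlib

universe u

/-- A pseudovariety of monoids: a class of finite monoids closed under finite direct products
(including the empty product, the trivial monoid), submonoids and homomorphic images.
Closure under isomorphism is a special case of the last two conditions. -/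
structure MonoidPseudovariety where
  Mem : ∀ (M : Type u) [Monoid M], Prop
  finite_of_mem : ∀ (M : Type u) [Monoid M], Mem M → Finite M
  mem_unit : Mem PUnit.{u + 1}
  mem_prod : ∀ (M N : Type u) [Monoid M] [Monoid N], Mem M → Mem N → Mem (M × N)
  mem_of_injective : ∀ (M N : Type u) [Monoid M] [Monoid N] (f : M →* N),
    Function.Injective f → Mem N → Mem M
  mem_of_surjective : ∀ (M N : Type u) [Monoid M] [Monoid N] (f : M →* N),
    Function.Surjective f → Mem M → Mem N

/-- A pseudovariety of groups: a class of finite groups closed under finite direct products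
(including the empty product, the trivial group), subgroups and homomorphic images. -/
structure GroupPseudovariety where
  Mem : ∀ (G : Type u) [Group G], Prop
  finite_of_mem : ∀ (G : Type u) [Group G], Mem G → Finite G
  mem_unit : Mem PUnit.{u + 1}
  mem_prod : ∀ (G K : Type u) [Group G] [Group K], Mem G → Mem K → Mem (G × K)
  mem_of_injective : ∀ (G K : Type u) [Group G] [Group K] (f : G →* K),
    Function.Injective f → Mem K → Mem G
  mem_of_surjective : ∀ (G K : Type u) [Group G] [Group K] (f : G →* K),
    Function.Surjective f → Mem G → Mem K

/-- `H` is Fitting if, in every finite group, the product of two normal subgroups belonging to `H`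
belongs to `H`. (For normal subgroups `A` and `B`, the join `A ⊔ B` is the product `AB`.) -/
def GroupPseudovariety.IsFitting (H : GroupPseudovariety.{u}) : Prop :=
  ∀ (G : Type u) [Group G] [Finite G] (A B : Subgroup G), A.Normal → B.Normal →
    H.Mem A → H.Mem B → H.Mem (A ⊔ B : Subgroup G)

/-- The class `LH` of all finite semigroups `S` whose local monoids `eSe`, with `e` an idempotent
of `S`, belong to `H`, i.e. are groups belonging to `H`. -/
def GroupPseudovariety.LocallyMem (H : GroupPseudovariety.{u}) (S : Type u) [Semigroup S] : Prop :=
  Finite S ∧ ∀ e : S, IsIdempotentElem e →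
    ∃ (G : Type u) (_ : Group G), H.Mem G ∧ Nonempty (G ≃* Subsemigroup.corner e)

/-- The inverse image `φ⁻¹(e)` of an idempotent `e` under a homomorphism `φ`, a subsemigroup. -/
def idempotentFiber {M N : Type u} [Monoid M] [Monoid N] (φ : M →* N) (e : N)
    (he : IsIdempotentElem e) : Subsemigroup M where
  carrier := {m | φ m = e}
  mul_mem' := by
    intro a b ha hb
    have ha' : φ a = e := ha
    have hb' : φ b = e := hb
    change φ (a * b) = e
    rw [map_mul, ha', hb', he.eq]

/-- An `LH`-morphism of monoids: a surjective homomorphism such that the inverse image of every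
idempotent belongs to `LH`. -/
def IsLHMorphism (H : GroupPseudovariety.{u}) {M N : Type u} [Monoid M] [Monoid N]
    (φ : M →* N) : Prop :=
  Function.Surjective φ ∧
    ∀ (e : N) (he : IsIdempotentElem e), H.LocallyMem (idempotentFiber φ e he)

/-- The pseudovariety of monoids generated by a class `K` of finite monoids (the members of `K`
that are not finite are ignored). -/
def MonoidPseudovariety.generate (K : ∀ (M : Type u) [Monoid M], Prop) :
    MonoidPseudovariety.{u} where
  Mem M _ := Finite M ∧ ∀ W : MonoidPseudovariety.{u},
    (∀ (N : Type u) [Monoid N], Finite N → K N → W.Mem N) → W.Mem M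
  finite_of_mem _ _ h := h.1
  mem_unit := ⟨inferInstance, fun W _ => W.mem_unit⟩
  mem_prod M N _ _ hM hN :=
    ⟨by have := hM.1; have := hN.1; infer_instance,
      fun W hW => W.mem_prod M N (hM.2 W hW) (hN.2 W hW)⟩
  mem_of_injective M N _ _ f hf hN :=
    ⟨by have := hN.1; exact Finite.of_injective f hf,
      fun W hW => W.mem_of_injective M N f hf (hN.2 W hW)⟩
  mem_of_surjective M N _ _ f hf hM :=
    ⟨by have := hM.1; exact Finite.of_surjective f hf,
      fun W hW => W.mem_of_surjective M N f hf (hM.2 W hW)⟩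

/-- The Mal'cev product of a class `K` of semigroups and a pseudovariety `V` of monoids: the
pseudovariety generated by all finite monoids `M` with a homomorphism `φ : M →* N`, `N` in `V`,
such that `φ⁻¹(e)` belongs to `K` for each idempotent `e` of `N`. -/
def malcevProduct (K : ∀ (S : Type u) [Semigroup S], Prop) (V : MonoidPseudovariety.{u}) :
    MonoidPseudovariety.{u} :=
  MonoidPseudovariety.generate fun M _ =>
    ∃ (N : Type u) (_ : Monoid N), V.Mem N ∧ ∃ φ : M →* N,
      ∀ (e : N) (he : IsIdempotentElem e), K (idempotentFiber φ e he)

/-- The multiplication table, as a list of rows, of a finite structure whose elements have been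
numbered `0, …, n - 1` by `e`. -/
def mulTable {M : Type u} [Mul M] {n : ℕ} (e : M ≃ Fin n) : List (List ℕ) :=
  List.ofFn fun i : Fin n => List.ofFn fun j : Fin n => (e (e.symm i * e.symm j) : ℕ)

/-- `V` is decidable: there is an algorithm deciding whether a given list of lists is a
multiplication table of a monoid in `V`. -/
def MonoidPseudovariety.IsDecidable (V : MonoidPseudovariety.{u}) : Prop :=
  ComputablePred fun t : List (List ℕ) =>
    ∃ (M : Type u) (_ : Monoid M) (n : ℕ) (e : M ≃ Fin n), V.Mem M ∧ mulTable e = t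

/-- `H` is decidable: there is an algorithm deciding whether a given list of lists is a
multiplication table of a group in `H`. -/
def GroupPseudovariety.IsDecidable (H : GroupPseudovariety.{u}) : Prop :=
  ComputablePred fun t : List (List ℕ) =>
    ∃ (G : Type u) (_ : Group G) (n : ℕ) (e : G ≃ Fin n), H.Mem G ∧ mulTable e = t

/-! The real content is that the finite monoids with an `LH`-morphism to a member of `V` already
form a pseudovariety (`lhExtensions`); the Mal'cev product is then this class. Only closure under
quotients is hard, and it uses the Fitting hypothesis, through which every finite group has a
largest normal subgroup in `H`, its radical. Declare `s` and `t` congruent if, for all `e`, `x`,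
`y`, the elements `exsye` and `extye` are either both non-units of `eMe`, or both units in the same
coset of the radical of its unit group.

The projection modulo this congruence has local kernels in `H` (`hasLocalKernelsIn_radicalCon`),
every other morphism with such kernels identifies only congruent elements (`radicalCon_of_eq`), and
surjections preserve the congruence (`radicalCon_map`). So if `φ : M → A` has local kernels in `H`
and `ψ : M → Q` is onto, the quotient of `Q` by its own radical congruence is a quotient of the
image of `φ`, hence lies in `V`.

For decidability, a finite monoid has finitely many congruences. Each is coded by a choice of
representatives, and the tables of its quotient and local kernels are passed to the algorithms for
`V` and `H`. -/

/-! ### Local monoids and lifting of idempotents -/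

section LocalMonoid

variable {M N Q : Type u} [Monoid M] [Monoid N] [Monoid Q]

/-- The local monoid `eMe` at an idempotent `e`. -/
def LocalMonoid {e : M} (_ : IsIdempotentElem e) : Type u := Subsemigroup.corner e

namespace LocalMonoid

variable {e : M} {he : IsIdempotentElem e}

/-- The element of `M` underlying an element of `eMe`. -/
def val (s : LocalMonoid he) : M := Subtype.val s

theorem mul_val (s : LocalMonoid he) : e * s.val = s.val :=
  ((Subsemigroup.mem_corner_iff he).1 s.2).1

theorem val_mul (s : LocalMonoid he) : s.val * e = s.val :=
  ((Subsemigroup.mem_corner_iff he).1 s.2).2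

theorem val_injective : Function.Injective (val : LocalMonoid he → M) := Subtype.val_injective

/-- An element absorbed by `e` on both sides, as an element of `eMe`. -/
def ofMem (he : IsIdempotentElem e) (m : M) (h₁ : e * m = m) (h₂ : m * e = m) : LocalMonoid he :=
  ⟨m, (Subsemigroup.mem_corner_iff he).2 ⟨h₁, h₂⟩⟩

@[simp] theorem val_ofMem (m : M) (h₁ : e * m = m) (h₂ : m * e = m) :
    (ofMem he m h₁ h₂).val = m := rfl

instance : Monoid (LocalMonoid he) where
  mul s t := ofMem he (s.val * t.val) (by rw [← mul_assoc, s.mul_val])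
    (by rw [mul_assoc, t.val_mul])
  mul_assoc s t r := val_injective (mul_assoc s.val t.val r.val)
  one := ofMem he e he he
  one_mul s := val_injective s.mul_val
  mul_one s := val_injective s.val_mul

@[simp] theorem val_one : (1 : LocalMonoid he).val = e := rfl

@[simp] theorem val_mul' (s t : LocalMonoid he) : (s * t).val = s.val * t.val := rfl

instance [Finite M] : Finite (LocalMonoid he) := Finite.of_injective _ val_injective

/-- The element `eme` of `eMe`. -/
def sandwich (he : IsIdempotentElem e) (m : M) : LocalMonoid he :=
  ofMem he (e * m * e) (by rw [← mul_assoc, ← mul_assoc, he.eq]) (by rw [mul_assoc, he.eq])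

@[simp] theorem val_sandwich (m : M) : (sandwich he m).val = e * m * e := rfl

theorem sandwich_val (s : LocalMonoid he) : sandwich he s.val = s :=
  val_injective (by simp [s.mul_val, s.val_mul])

/-- The homomorphism of local monoids induced by a homomorphism. -/
def map (φ : M →* N) (he : IsIdempotentElem e) : LocalMonoid he →* LocalMonoid (he.map φ) where
  toFun s := ofMem _ (φ s.val) (by rw [← map_mul, s.mul_val]) (by rw [← map_mul, s.val_mul])
  map_one' := rfl
  map_mul' s t := val_injective (by simp)

@[simp] theorem val_map (φ : M →* N) (s : LocalMonoid he) : (map φ he s).val = φ s.val := rfl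

theorem map_eq_one_iff (φ : M →* N) (s : LocalMonoid he) :
    map φ he s = 1 ↔ φ s.val = φ e :=
  val_injective.eq_iff.symm

theorem map_sandwich (φ : M →* N) (m : M) :
    map φ he (sandwich he m) = sandwich (he.map φ) (φ m) :=
  val_injective (by simp)

theorem map_surjective (φ : M →* N) (hφ : Function.Surjective φ) (he : IsIdempotentElem e) :
    Function.Surjective (map φ he) := fun s => by
  obtain ⟨m, hm⟩ := hφ s.val
  exact ⟨sandwich he m, by rw [map_sandwich, hm, sandwich_val]⟩

end LocalMonoid

theorem exists_pow_isIdempotentElem [Finite M] (m : M) : ∃ k ≠ 0, IsIdempotentElem (m ^ k) := by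
  obtain ⟨i, j, hij, h⟩ := Finite.exists_ne_map_eq_of_infinite (fun k : ℕ => m ^ k)
  wlog hlt : i < j generalizing i j
  · exact this j i hij.symm h.symm (by omega)
  obtain ⟨p, rfl⟩ := Nat.exists_eq_add_of_lt hlt
  have key : ∀ q a, m ^ (i + a + (p + 1) * q) = m ^ (i + a) := by
    intro q a
    induction q with
    | zero => simp
    | succ q ih =>
      rw [← ih]
      have h' : m ^ (i + p + 1) = m ^ i := h.symm
      calc m ^ (i + a + (p + 1) * (q + 1)) = m ^ (i + p + 1) * m ^ (a + (p + 1) * q) := by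
            rw [← pow_add]; congr 1; ring
        _ = _ := by rw [h', ← pow_add]; congr 1; ring
  -- The exponent must be a nonzero multiple of the period `p + 1` that is at least the index `i`;
  -- the factor `i + 1` also covers `i = 0`.
  refine ⟨(p + 1) * (i + 1), by positivity, ?_⟩
  have := key (i + 1) ((p + 1) * (i + 1) - i)
  have hle : i ≤ (p + 1) * (i + 1) := by nlinarith [Nat.zero_le p, Nat.zero_le (p * i)]
  rw [Nat.add_sub_cancel' hle, pow_add] at this
  exact this

/-- An idempotent has a preimage such that units of its local monoid are reflected. -/
theorem exists_lift_idempotent [Finite M] (ψ : M →* Q) (hψ : Function.Surjective ψ) {e : Q}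
    (he : IsIdempotentElem e) : ∃ (e' : M) (he' : IsIdempotentElem e'), ψ e' = e ∧
      ∀ s : LocalMonoid he', IsUnit (LocalMonoid.map ψ he' s) → IsUnit s := by
  let S : Set M := {f | IsIdempotentElem f ∧ ψ f = e}
  have hS : S.Nonempty := by
    obtain ⟨m, rfl⟩ := hψ e
    obtain ⟨k, hk, hm⟩ := exists_pow_isIdempotentElem m
    exact ⟨m ^ k, hm, by rw [map_pow, he.pow_eq hk]⟩
  -- Among the idempotents over `e`, take `f` with the smallest local monoid `fMf`.
  let d : M → ℕ := fun f => Nat.card {s : M // f * s = s ∧ s * f = s}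
  obtain ⟨f, ⟨hf, hfe⟩, hmin⟩ := Set.exists_min_image S d S.toFinite hS
  refine ⟨f, hf, hfe, fun s hs => ?_⟩
  obtain ⟨k, hk, hidem⟩ := exists_pow_isIdempotentElem s
  have hmap : LocalMonoid.map ψ hf (s ^ k) = 1 := by
    have h1 : IsUnit (LocalMonoid.map ψ hf (s ^ k)) := by rw [map_pow]; exact hs.pow k
    exact (IsIdempotentElem.iff_eq_one_of_isUnit h1).1 (hidem.map _)
  set g := s ^ k with hg
  -- The idempotent power `g` of `s` again lies over `e`, and `gMg ⊆ fMf`. Minimality forces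
  -- equality, so `f ∈ gMg` and `g = f`; thus a power of `s` is the identity of `fMf`.
  have hgS : g.val ∈ S := by
    refine ⟨?_, ?_⟩
    · have := congrArg LocalMonoid.val hidem.eq
      exact this
    · rw [← hfe]; exact (LocalMonoid.map_eq_one_iff ψ g).1 hmap
  have hle := hmin _ hgS
  let ι : {s : M // g.val * s = s ∧ s * g.val = s} → {s : M // f * s = s ∧ s * f = s} :=
    fun s => ⟨s.1, by rw [← s.2.1, ← mul_assoc, g.mul_val], by rw [← s.2.2, mul_assoc, g.val_mul]⟩
  have hι : Function.Injective ι := fun a b h => Subtype.ext (Subtype.ext_iff.1 h :)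
  have hb : Function.Bijective ι := by
    have : Nat.card {s : M // g.val * s = s ∧ s * g.val = s} =
        Nat.card {s : M // f * s = s ∧ s * f = s} :=
      le_antisymm (Nat.card_le_card_of_injective ι hι) hle
    exact (Nat.bijective_iff_injective_and_card ι).2 ⟨hι, this⟩
  obtain ⟨a, ha⟩ := hb.2 ⟨f, hf, hf⟩
  have haf : a.1 = f := congrArg Subtype.val ha
  have h1 : g.val = f := by
    have := a.2.1
    rw [haf, g.val_mul] at this
    exact this
  have h2 : s ^ k = 1 := LocalMonoid.val_injective h1
  exact IsUnit.of_pow_eq_one h2 hk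

end LocalMonoid

/-! ### Local kernels of `LH`-morphisms -/

section LHMorphisms

variable {M N Q : Type u} [Monoid M] [Monoid N] [Monoid Q]

/-- Every element of a local monoid `eMe` with the same image as `e` is a unit of `eMe`, and these
elements form a group in `H`. -/
def HasLocalKernelsIn (H : GroupPseudovariety.{u}) (φ : M →* N) : Prop :=
  ∀ (e : M) (he : IsIdempotentElem e),
    (∀ s : LocalMonoid he, LocalMonoid.map φ he s = 1 → IsUnit s) ∧
      H.Mem (Units.map (LocalMonoid.map φ he)).ker

section Fibers

open Subsemigroup

/-- The local monoid at `e` of the fibre over `φ e` is the kernel of `eMe → φ(e)Nφ(e)`. -/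
def cornerFiberEquiv (φ : M →* N) {e : M} (he : IsIdempotentElem e) (hφe : IsIdempotentElem (φ e)) :
    corner (⟨e, rfl⟩ : idempotentFiber φ (φ e) hφe) ≃* MonoidHom.mker (LocalMonoid.map φ he) :=
  have hê : IsIdempotentElem (⟨e, rfl⟩ : idempotentFiber φ (φ e) hφe) := Subtype.ext he
  { toFun := fun s => ⟨LocalMonoid.ofMem he s.1.1
        (congrArg Subtype.val ((mem_corner_iff hê).1 s.2).1)
        (congrArg Subtype.val ((mem_corner_iff hê).1 s.2).2),
      (LocalMonoid.map_eq_one_iff φ _).2 s.1.2⟩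
    invFun := fun s => ⟨⟨s.1.val, (LocalMonoid.map_eq_one_iff φ _).1 s.2⟩,
      (mem_corner_iff hê).2 ⟨Subtype.ext s.1.mul_val,
        Subtype.ext s.1.val_mul⟩⟩
    left_inv := fun _ => rfl
    right_inv := fun _ => rfl
    map_mul' := fun _ _ => rfl }

/-- The kernel submonoid shares its identity with `M`, so if it is a group its inverses are inverses
in `M`, and it coincides with the kernel on units. -/
theorem exists_mulEquiv_mker_iff (H : GroupPseudovariety.{u}) (φ : M →* N) :
    (∃ (G : Type u) (_ : Group G), H.Mem G ∧ Nonempty (G ≃* MonoidHom.mker φ)) ↔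
      (∀ s, φ s = 1 → IsUnit s) ∧ H.Mem (Units.map φ).ker := by
  constructor
  · rintro ⟨G, _, hG, ⟨σ⟩⟩
    refine ⟨fun s hs => ?_, ?_⟩
    · have := (Group.isUnit (σ.symm ⟨s, hs⟩)).map ((MonoidHom.mker φ).subtype.comp σ.toMonoidHom)
      simpa using this
    · let ι : (Units.map φ).ker →* MonoidHom.mker φ :=
        { toFun := fun g => ⟨(g.1 : M), congrArg Units.val g.2⟩
          map_one' := rfl
          map_mul' := fun _ _ => rfl }
      refine H.mem_of_injective _ G (σ.symm.toMonoidHom.comp ι) ?_ hG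
      refine σ.symm.injective.comp fun a b h => ?_
      exact Subtype.ext (Units.ext (Subtype.ext_iff.1 h :))
  · rintro ⟨h₁, h₂⟩
    refine ⟨_, _, h₂, ⟨MulEquiv.ofBijective (⟨⟨fun g => ⟨(g.1 : M), congrArg Units.val g.2⟩, rfl⟩,
      fun _ _ => rfl⟩ : (Units.map φ).ker →* MonoidHom.mker φ) ⟨fun a b h => ?_, fun s => ?_⟩⟩⟩
    · exact Subtype.ext (Units.ext (Subtype.ext_iff.1 h :))
    · obtain ⟨u, hu⟩ := h₁ s.1 s.2
      exact ⟨⟨u, Units.ext (by have := s.2; rw [← hu] at this; exact this)⟩, Subtype.ext hu⟩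

/-- The idempotents of the fibres over idempotents are exactly the idempotents of `M`. Fibres that
are empty impose nothing, so surjectivity plays no role. -/
theorem locallyMem_fibers_iff [Finite M] (H : GroupPseudovariety.{u}) (φ : M →* N) :
    (∀ (f : N) (hf : IsIdempotentElem f), H.LocallyMem (idempotentFiber φ f hf)) ↔
      HasLocalKernelsIn H φ := by
  constructor
  · intro h e he
    rw [← exists_mulEquiv_mker_iff]
    obtain ⟨G, _, hG, ⟨σ⟩⟩ := (h (φ e) (he.map φ)).2 ⟨e, rfl⟩ (Subtype.ext he)
    exact ⟨G, _, hG, ⟨σ.trans (cornerFiberEquiv φ he _)⟩⟩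
  · intro h f hf
    refine ⟨inferInstance, ?_⟩
    rintro ⟨e, hφe⟩ hê
    change φ e = f at hφe
    subst hφe
    have he : IsIdempotentElem e := congrArg Subtype.val hê
    obtain ⟨G, _, hG, ⟨σ⟩⟩ := (exists_mulEquiv_mker_iff H _).2 (h e he)
    exact ⟨G, _, hG, ⟨σ.trans (cornerFiberEquiv φ he _).symm⟩⟩

end Fibers

namespace HasLocalKernelsIn

variable {H : GroupPseudovariety.{u}}

theorem of_ker_le {φ : M →* N} {ψ : M →* Q} (hφ : HasLocalKernelsIn H φ)
    (h : ∀ s t, ψ s = ψ t → φ s = φ t) : HasLocalKernelsIn H ψ := fun e he => by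
  have key : ∀ s : LocalMonoid he, LocalMonoid.map ψ he s = 1 → LocalMonoid.map φ he s = 1 :=
    fun s hs => (LocalMonoid.map_eq_one_iff φ s).2 (h _ _ ((LocalMonoid.map_eq_one_iff ψ s).1 hs))
  refine ⟨fun s hs => (hφ e he).1 s (key s hs), ?_⟩
  refine H.mem_of_injective _ _ (Subgroup.inclusion (fun g hg => ?_))
    (Subgroup.inclusion_injective _) (hφ e he).2
  exact Units.ext (key _ (congrArg Units.val hg))

theorem comp_injective [Finite M] {φ : M →* N} (hφ : HasLocalKernelsIn H φ) (f : Q →* M)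
    (hf : Function.Injective f) : HasLocalKernelsIn H (φ.comp f) := fun e he => by
  have hfin : Finite Q := Finite.of_injective f hf
  have hinj : Function.Injective (LocalMonoid.map f he) := fun a b h =>
    LocalMonoid.val_injective (hf (congrArg LocalMonoid.val h))
  refine ⟨fun s hs => ?_, ?_⟩
  · have hu : IsUnit (LocalMonoid.map f he s) :=
      (hφ (f e) (he.map f)).1 _ hs
    -- The inverse of the image of `s` might lie outside `Q`. Finiteness helps: an idempotent power
    -- of `s` has a unit as image, hence is the identity.
    obtain ⟨k, hk, hs⟩ := exists_pow_isIdempotentElem s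
    refine IsUnit.of_pow_eq_one (n := k) (hinj ?_) hk
    have := hu.pow k
    rw [← map_pow] at this
    rw [(IsIdempotentElem.iff_eq_one_of_isUnit this).1 (hs.map _), map_one]
  · refine H.mem_of_injective _ _ (((Units.map (LocalMonoid.map f he)).comp
      (Subgroup.subtype _)).codRestrict _ fun g => ?_) ?_ (hφ (f e) (he.map f)).2
    · exact g.2
    · refine (MonoidHom.injective_codRestrict _ _ _).2 ?_
      exact (Units.map_injective hinj).comp Subtype.val_injective

theorem prodMap {M' N' : Type u} [Monoid M'] [Monoid N'] {φ : M →* N} {ψ : M' →* N'}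
    (hφ : HasLocalKernelsIn H φ) (hψ : HasLocalKernelsIn H ψ) :
    HasLocalKernelsIn H (φ.prodMap ψ) := fun e he => by
  have he₁ := he.map (MonoidHom.fst M M')
  have he₂ := he.map (MonoidHom.snd M M')
  have key : ∀ s : LocalMonoid he, LocalMonoid.map (φ.prodMap ψ) he s = 1 →
      LocalMonoid.map φ he₁ (LocalMonoid.map (MonoidHom.fst M M') he s) = 1 ∧
      LocalMonoid.map ψ he₂ (LocalMonoid.map (MonoidHom.snd M M') he s) = 1 := fun s hs => by
    rw [LocalMonoid.map_eq_one_iff] at hs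
    exact ⟨LocalMonoid.val_injective (congrArg Prod.fst hs),
      LocalMonoid.val_injective (congrArg Prod.snd hs)⟩
  refine ⟨fun s hs => ?_, ?_⟩
  · obtain ⟨u, hu⟩ := (hφ _ he₁).1 _ (key s hs).1
    obtain ⟨v, hv⟩ := (hψ _ he₂).1 _ (key s hs).2
    have hu' : u.1.val = s.val.1 := congrArg LocalMonoid.val hu
    have hv' : v.1.val = s.val.2 := congrArg LocalMonoid.val hv
    -- The local monoid at a pair is the product of the local monoids, so inverses are taken
    -- coordinatewise.
    let t : LocalMonoid he := LocalMonoid.ofMem he ((u⁻¹).1.val, (v⁻¹).1.val)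
      (Prod.ext (u⁻¹).1.mul_val (v⁻¹).1.mul_val) (Prod.ext (u⁻¹).1.val_mul (v⁻¹).1.val_mul)
    refine ⟨⟨s, t, LocalMonoid.val_injective (Prod.ext ?_ ?_),
      LocalMonoid.val_injective (Prod.ext ?_ ?_)⟩, rfl⟩
    · change s.val.1 * _ = e.1
      rw [← hu']; exact congrArg LocalMonoid.val u.mul_inv
    · change s.val.2 * _ = e.2
      rw [← hv']; exact congrArg LocalMonoid.val v.mul_inv
    · change _ * s.val.1 = e.1
      rw [← hu']; exact congrArg LocalMonoid.val u.inv_mul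
    · change _ * s.val.2 = e.2
      rw [← hv']; exact congrArg LocalMonoid.val v.inv_mul
  · let F₁ : (Units.map (LocalMonoid.map (φ.prodMap ψ) he)).ker →*
        (Units.map (LocalMonoid.map φ he₁)).ker :=
      { toFun := fun g => ⟨Units.map (LocalMonoid.map (MonoidHom.fst M M') he) g.1,
          Units.ext (key g.1.1 (congrArg Units.val g.2)).1⟩
        map_one' := rfl
        map_mul' := fun _ _ => rfl }
    let F₂ : (Units.map (LocalMonoid.map (φ.prodMap ψ) he)).ker →*
        (Units.map (LocalMonoid.map ψ he₂)).ker :=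
      { toFun := fun g => ⟨Units.map (LocalMonoid.map (MonoidHom.snd M M') he) g.1,
          Units.ext (key g.1.1 (congrArg Units.val g.2)).2⟩
        map_one' := rfl
        map_mul' := fun _ _ => rfl }
    refine H.mem_of_injective _ _ (F₁.prod F₂) ?_
      (H.mem_prod _ _ (hφ _ he₁).2 (hψ _ he₂).2)
    intro a b h
    have h₁ := congrArg (fun p => p.1.1.1.val) h
    have h₂ := congrArg (fun p => p.2.1.1.val) h
    exact Subtype.ext (Units.ext (LocalMonoid.val_injective (Prod.ext h₁ h₂)))

end HasLocalKernelsIn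

/-! ### The radical of a finite group -/

section Radical

variable {H : GroupPseudovariety.{u}}

/-- A maximal normal subgroup in `H` absorbs every other one, since by the Fitting property their
join is again a candidate. -/
theorem GroupPseudovariety.IsFitting.exists_radical (hH : H.IsFitting) (G : Type u) [Group G]
    [Finite G] : ∃ R : Subgroup G, R.Normal ∧ H.Mem R ∧
      ∀ A : Subgroup G, A.Normal → H.Mem A → A ≤ R := by
  have hne : {A : Subgroup G | A.Normal ∧ H.Mem A}.Nonempty := by
    refine ⟨⊥, inferInstance, H.mem_of_injective _ PUnit.{u + 1} 1 ?_ H.mem_unit⟩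
    exact fun a b _ => Subsingleton.elim a b
  obtain ⟨R, ⟨hR, hRH⟩, hmax⟩ := (Set.toFinite _).exists_maximal hne
  refine ⟨R, hR, hRH, fun A hA hAH => ?_⟩
  have := hmax (y := A ⊔ R) ⟨inferInstance, hH G A R hA hR hAH hRH⟩ le_sup_right
  exact le_sup_left.trans this

/-- The largest normal subgroup belonging to a Fitting pseudovariety. -/
noncomputable def GroupPseudovariety.IsFitting.radical (hH : H.IsFitting) (G : Type u) [Group G]
    [Finite G] : Subgroup G := (hH.exists_radical G).choose

variable (hH : H.IsFitting) {G K : Type u} [Group G] [Finite G] [Group K] [Finite K]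

instance : (hH.radical G).Normal := (hH.exists_radical G).choose_spec.1

theorem GroupPseudovariety.IsFitting.mem_radical : H.Mem (hH.radical G) :=
  (hH.exists_radical G).choose_spec.2.1

theorem GroupPseudovariety.IsFitting.le_radical (A : Subgroup G) [hA : A.Normal] (h : H.Mem A) :
    A ≤ hH.radical G := (hH.exists_radical G).choose_spec.2.2 A hA h

theorem GroupPseudovariety.IsFitting.map_radical_le (f : G →* K) (hf : Function.Surjective f) :
    (hH.radical G).map f ≤ hH.radical K := by
  have : ((hH.radical G).map f).Normal := Subgroup.Normal.map inferInstance f hf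
  exact hH.le_radical _ (H.mem_of_surjective _ _ _ (f.subgroupMap_surjective _) hH.mem_radical)

end Radical

/-! ### The radical congruence and its functoriality -/

section RadicalCongruence

variable {H : GroupPseudovariety.{u}} (hH : H.IsFitting) [Finite M] [Finite Q]

/-- The coset of the radical of the group of units of `eMe` determined by `exsye`, which is empty
if `exsye` is not a unit of `eMe`. -/
def radicalCoset (s : M) {e : M} (he : IsIdempotentElem e) (x y : M) : Set (LocalMonoid he)ˣ :=
  {g | ∃ h : (LocalMonoid he)ˣ, (h : LocalMonoid he) = LocalMonoid.sandwich he (x * s * y) ∧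
    h⁻¹ * g ∈ hH.radical (LocalMonoid he)ˣ}

/-- The largest congruence `c` on `M` such that `M → M/c` is an `LH`-morphism. -/
def radicalCon (M : Type u) [Monoid M] [Finite M] : Con M where
  r s t := ∀ (e : M) (he : IsIdempotentElem e) (x y : M),
    radicalCoset hH s he x y = radicalCoset hH t he x y
  iseqv := ⟨fun _ _ _ _ _ => rfl, fun h e he x y => (h e he x y).symm,
    fun h₁ h₂ e he x y => (h₁ e he x y).trans (h₂ e he x y)⟩
  mul' {s s' t t'} h₁ h₂ e he x y := by
    -- The factors are replaced one at a time, the other factor being moved into the context `x`,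
    -- `y`.
    have h₃ := h₁ e he x (t * y)
    have h₄ := h₂ e he (x * s') y
    simp only [radicalCoset, mul_assoc] at h₃ h₄ ⊢
    exact h₃.trans h₄

/-- If `h = exsye` is a unit, then `h⁻¹ · extye` lies in the local kernel of `φ`, which is a normal
subgroup in `H` of the unit group and so is contained in the radical. -/
theorem HasLocalKernelsIn.radicalCon_of_eq {φ : M →* N} (hφ : HasLocalKernelsIn H φ) {s t : M}
    (h : φ s = φ t) : radicalCon hH M s t := by
  have key : ∀ {s t : M}, φ s = φ t → ∀ (e : M) (he : IsIdempotentElem e) (x y : M),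
      radicalCoset hH s he x y ⊆ radicalCoset hH t he x y := by
    rintro s t hst e he x y g ⟨h, hh, hg⟩
    have h₁ : LocalMonoid.map φ he (LocalMonoid.sandwich he (x * t * y)) =
        LocalMonoid.map φ he h := by
      rw [hh, LocalMonoid.map_sandwich, LocalMonoid.map_sandwich]
      simp [hst]
    have h₂ : LocalMonoid.map φ he (((h⁻¹ : (LocalMonoid he)ˣ) : LocalMonoid he) *
        LocalMonoid.sandwich he (x * t * y)) = 1 := by
      rw [map_mul, h₁, ← map_mul, Units.inv_mul, map_one]
    obtain ⟨k, hk⟩ := (hφ e he).1 _ h₂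
    have hkr : k ∈ hH.radical (LocalMonoid he)ˣ :=
      hH.le_radical _ (hφ e he).2 (Units.ext ((congrArg _ hk).trans h₂))
    refine ⟨h * k, by simp [hk], ?_⟩
    rw [mul_inv_rev, mul_assoc]
    exact mul_mem (inv_mem hkr) hg
  exact fun e he x y => (key h e he x y).antisymm (key h.symm e he x y)

/-- In the context `x = y = 1` the coset attached to `e` is the radical itself, so an element of
`eMe` congruent to `e` is a unit in the radical. -/
theorem hasLocalKernelsIn_radicalCon : HasLocalKernelsIn H (radicalCon hH M).mk' := fun e he => by
  have key : ∀ s : LocalMonoid he, LocalMonoid.map (radicalCon hH M).mk' he s = 1 →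
      ∃ g ∈ hH.radical (LocalMonoid he)ˣ, (g : LocalMonoid he) = s := fun s hs => by
    have hs' := (Con.eq _).1 ((LocalMonoid.map_eq_one_iff _ s).1 hs) e he 1 1
    have h1 : (1 : (LocalMonoid he)ˣ) ∈ radicalCoset hH e he 1 1 := by
      refine ⟨1, LocalMonoid.val_injective ?_, by simp⟩
      simp [he.eq]
    rw [← hs'] at h1
    obtain ⟨h, hh, hm⟩ := h1
    refine ⟨h, by simpa using hm, ?_⟩
    rw [hh, one_mul, mul_one, LocalMonoid.sandwich_val]
  refine ⟨fun s hs => ?_, ?_⟩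
  · obtain ⟨g, -, rfl⟩ := key s hs
    exact g.isUnit
  · refine H.mem_of_injective _ _ (Subgroup.inclusion (fun g hg => ?_))
      (Subgroup.inclusion_injective _) (hH.mem_radical (G := (LocalMonoid he)ˣ))
    obtain ⟨k, hk, hkg⟩ := key _ (congrArg Units.val hg)
    rwa [← Units.ext hkg]

/-- Over a lifted idempotent whose units are reflected, the unit groups map onto each other, so the
radical maps into the radical and cosets can be compared upstairs. -/
theorem radicalCon_map {ψ : M →* Q} (hψ : Function.Surjective ψ) {s t : M}
    (h : radicalCon hH M s t) : radicalCon hH Q (ψ s) (ψ t) := by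
  have key : ∀ {s t : M}, radicalCon hH M s t → ∀ (e : Q) (he : IsIdempotentElem e) (x y : Q),
      radicalCoset hH (ψ s) he x y ⊆ radicalCoset hH (ψ t) he x y := by
    rintro s t hst e he x y
    obtain ⟨e, he', rfl, hlift⟩ := exists_lift_idempotent ψ hψ he
    obtain ⟨x, rfl⟩ := hψ x
    obtain ⟨y, rfl⟩ := hψ y
    rintro g ⟨h, hh, hg⟩
    have hsurj : Function.Surjective (Units.map (LocalMonoid.map ψ he')) := fun u => by
      obtain ⟨a, ha⟩ := LocalMonoid.map_surjective ψ hψ he' u.1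
      obtain ⟨v, rfl⟩ := hlift a (by rw [ha]; exact u.isUnit)
      exact ⟨v, Units.ext ha⟩
    rw [← map_mul, ← map_mul, ← LocalMonoid.map_sandwich] at hh
    obtain ⟨h', hh'⟩ := hlift (LocalMonoid.sandwich he' (x * s * y)) (by
      rw [← hh]; exact h.isUnit)
    have h1 : h' ∈ radicalCoset hH s he' x y := ⟨h', hh', by simp⟩
    rw [hst] at h1
    obtain ⟨k, hk, hkh⟩ := h1
    have hhm : h = Units.map (LocalMonoid.map ψ he') h' := Units.ext (by
      rw [hh, ← hh']; rfl)
    refine ⟨Units.map (LocalMonoid.map ψ he') k, ?_, ?_⟩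
    · refine (congrArg (LocalMonoid.map ψ he') hk).trans ?_
      rw [LocalMonoid.map_sandwich, map_mul, map_mul]
    · have h2 := mul_mem (hH.map_radical_le _ hsurj (Subgroup.mem_map_of_mem _ hkh)) hg
      rw [map_mul, map_inv, ← hhm, mul_assoc, mul_inv_cancel_left] at h2
      exact h2
  exact fun e he x y => (key h e he x y).antisymm (key ((radicalCon hH M).symm h) e he x y)

end RadicalCongruence

/-! ### Closure under quotients and the Mal'cev product -/

section MalcevProduct

variable {H : GroupPseudovariety.{u}} (V : MonoidPseudovariety.{u})

/-- The pseudovariety of finite monoids admitting an `LH`-morphism to a member of `V`. -/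
def lhExtensions (hH : H.IsFitting) (V : MonoidPseudovariety.{u}) : MonoidPseudovariety.{u} where
  Mem M _ := Finite M ∧ ∃ (N : Type u) (_ : Monoid N), V.Mem N ∧
    ∃ φ : M →* N, HasLocalKernelsIn H φ
  finite_of_mem _ _ h := h.1
  mem_unit := ⟨inferInstance, PUnit, inferInstance, V.mem_unit, MonoidHom.id _, fun e he => by
    have : Subsingleton (LocalMonoid he) := LocalMonoid.val_injective.subsingleton
    refine ⟨fun s _ => by rw [Subsingleton.elim s 1]; exact isUnit_one, ?_⟩
    refine H.mem_of_injective _ PUnit 1 (fun a b _ => ?_) H.mem_unit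
    exact Subtype.ext (Units.ext (Subsingleton.elim _ _))⟩
  mem_prod M N _ _ := by
    rintro ⟨_, A, _, hA, φ, hφ⟩ ⟨_, B, _, hB, ψ, hψ⟩
    exact ⟨inferInstance, A × B, inferInstance, V.mem_prod A B hA hB, _, hφ.prodMap hψ⟩
  mem_of_injective M N _ _ f hf := by
    rintro ⟨_, A, _, hA, φ, hφ⟩
    exact ⟨Finite.of_injective f hf, A, _, hA, _, hφ.comp_injective f hf⟩
  mem_of_surjective M Q _ _ ψ hψ := by
    rintro ⟨_, A, _, hA, φ, hφ⟩
    have hQ : Finite Q := Finite.of_surjective ψ hψ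
    refine ⟨hQ, (radicalCon hH Q).Quotient, inferInstance, ?_, (radicalCon hH Q).mk',
      hasLocalKernelsIn_radicalCon hH⟩
    let B := MonoidHom.mrange φ
    have hB : V.Mem B := V.mem_of_injective _ _ B.subtype Subtype.val_injective hA
    let θ : M →* (radicalCon hH Q).Quotient := (radicalCon hH Q).mk'.comp ψ
    have hθ : Function.Surjective θ := Con.mk'_surjective.comp hψ
    -- This makes `θ` factor through the image of `φ`; the factor map is written with a
    -- set-theoretic section `σ`.
    have hle : ∀ s t, φ.mrangeRestrict s = φ.mrangeRestrict t → θ s = θ t := fun s t hst =>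
      (Con.eq _).2 (radicalCon_map hH hψ (hφ.radicalCon_of_eq hH (congrArg Subtype.val hst)))
    choose σ hσ using φ.mrangeRestrict_surjective
    have hσθ : ∀ s, θ (σ (φ.mrangeRestrict s)) = θ s := fun s => hle _ _ (hσ _)
    refine V.mem_of_surjective B _ ⟨⟨fun b => θ (σ b), ?_⟩, fun a b => ?_⟩ (fun q => ?_) hB
    · rw [← map_one φ.mrangeRestrict, hσθ, map_one]
    · change θ (σ (a * b)) = θ (σ a) * θ (σ b)
      rw [← map_mul]
      exact hle _ _ (by rw [hσ, map_mul, hσ, hσ])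
    · obtain ⟨m, rfl⟩ := hθ q
      exact ⟨φ.mrangeRestrict m, hσθ m⟩

theorem mem_malcevProduct_iff (hH : H.IsFitting) [Finite M] :
    (malcevProduct (fun S _ => H.LocallyMem S) V).Mem M ↔
      ∃ (N : Type u) (_ : Monoid N), V.Mem N ∧ ∃ φ : M →* N, HasLocalKernelsIn H φ := by
  constructor
  · intro h
    refine (h.2 (lhExtensions hH V) ?_).2
    rintro N _ hfin ⟨A, _, hA, φ, hφ⟩
    exact ⟨hfin, A, _, hA, φ, (locallyMem_fibers_iff H φ).1 hφ⟩
  · rintro ⟨A, _, hA, φ, hφ⟩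
    exact ⟨inferInstance, fun W hW =>
      hW M inferInstance ⟨A, _, hA, φ, (locallyMem_fibers_iff H φ).2 hφ⟩⟩

theorem isLHMorphism_iff [Finite M] (φ : M →* N) :
    IsLHMorphism H φ ↔ Function.Surjective φ ∧ HasLocalKernelsIn H φ := by
  rw [IsLHMorphism, locallyMem_fibers_iff]

/-- Corestricting to the image gives surjectivity: `V` is closed under submonoids and the kernel
congruence is unchanged. -/
theorem mem_malcevProduct_iff_exists_isLHMorphism (hH : H.IsFitting) [Finite M] :
    (malcevProduct (fun S _ => H.LocallyMem S) V).Mem M ↔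
      ∃ (N : Type u) (_ : Monoid N), V.Mem N ∧ ∃ φ : M →* N, IsLHMorphism H φ := by
  rw [mem_malcevProduct_iff V hH]
  constructor
  · rintro ⟨A, _, hA, φ, hφ⟩
    refine ⟨MonoidHom.mrange φ, inferInstance,
      V.mem_of_injective _ _ (MonoidHom.mrange φ).subtype Subtype.val_injective hA,
      φ.mrangeRestrict, (isLHMorphism_iff _).2 ⟨φ.mrangeRestrict_surjective,
        hφ.of_ker_le fun s t h => congrArg Subtype.val h⟩⟩
  · rintro ⟨A, _, hA, φ, hφ⟩
    exact ⟨A, _, hA, φ, ((isLHMorphism_iff φ).1 hφ).2⟩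

end MalcevProduct

end LHMorphisms

/-! ### Computable predicates on multiplication tables -/

section Computability

variable {α β : Type*} [Primcodable α] [Primcodable β]

theorem ComputablePred.comp_computable {p : β → Prop} (hp : ComputablePred p) {f : α → β}
    (hf : Computable f) : ComputablePred fun a => p (f a) := by
  obtain ⟨_, hp⟩ := hp
  exact ⟨fun a => inferInstance, hp.comp hf⟩

theorem ComputablePred.and_pred {p q : α → Prop} (hp : ComputablePred p) (hq : ComputablePred q) :
    ComputablePred fun a => p a ∧ q a := by
  classical
  exact Computable.computablePred <|
    (Primrec.and.to_comp.comp hp.decide hq.decide).of_eq fun a => by simp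

theorem ComputablePred.imp_pred {p q : α → Prop} (hp : ComputablePred p)
    (hq : ComputablePred q) : ComputablePred fun a => p a → q a :=
  (hp.and_pred hq.not).not.of_eq fun a => by simp

theorem Computable.eq_pred [DecidableEq β] {f g : α → β} (hf : Computable f) (hg : Computable g) :
    ComputablePred fun a => f a = g a :=
  (Primrec.eq (α := β)).computablePred.comp_computable (hf.pair hg)

theorem ComputablePred.forall_lt {p : α → ℕ → Prop}
    (hp : ComputablePred fun x : α × ℕ => p x.1 x.2) {g : α → ℕ} (hg : Computable g) :
    ComputablePred fun a => ∀ i < g a, p a i := by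
  classical
  refine Computable.computablePred ?_
  refine (Computable.nat_rec (h := fun a x => x.2 && decide (p a x.1)) hg
    (Computable.const true) ?_).of_eq fun a => ?_
  · exact (Primrec.and.to_comp.comp (Computable.snd.comp Computable.snd)
      (hp.decide.comp (Computable.fst.pair (Computable.fst.comp Computable.snd)))).to₂
  · induction g a with
    | zero => simp
    | succ n ih =>
      simp only at ih ⊢
      rw [ih, ← Bool.decide_and, decide_eq_decide, Nat.forall_lt_succ_right]

theorem ComputablePred.exists_lt {p : α → ℕ → Prop}
    (hp : ComputablePred fun x : α × ℕ => p x.1 x.2) {g : α → ℕ} (hg : Computable g) :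
    ComputablePred fun a => ∃ i < g a, p a i :=
  (ComputablePred.forall_lt (p := fun a i => ¬ p a i) hp.not hg).not.of_eq fun a => by simp

theorem Primrec.nat_pow : Primrec₂ ((· ^ ·) : ℕ → ℕ → ℕ) := Primrec₂.unpaired'.1 Nat.Primrec.pow

/-- The `(i, j)` entry of a table. -/
def tableOp (t : List (List ℕ)) (i j : ℕ) : ℕ := (t.getD i []).getD j 0

theorem Primrec.tableOp {t : α → List (List ℕ)} {i j : α → ℕ} (ht : Primrec t) (hi : Primrec i)
    (hj : Primrec j) : Primrec fun a => tableOp (t a) (i a) (j a) :=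
  (Primrec.list_getD 0).comp ((Primrec.list_getD []).comp ht hi) hj

/-- The multiplication table of an operation on the members of a list of natural numbers, each
member being represented by its index. -/
def opTable (op : ℕ → ℕ → ℕ) (R : List ℕ) : List (List ℕ) :=
  R.map fun i => R.map fun j => R.idxOf (op i j)

theorem Primrec.opTable {op : α → ℕ → ℕ → ℕ} {R : α → List ℕ}
    (hop : Primrec fun x : (α × ℕ) × ℕ => op x.1.1 x.1.2 x.2) (hR : Primrec R) :
    Primrec fun a => opTable (op a) (R a) := by
  have h : Primrec fun x : α × ℕ => (R x.1).map fun j => (R x.1).idxOf (op x.1 x.2 j) :=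
    Primrec.list_map (hR.comp Primrec.fst)
      (Primrec.list_idxOf.comp hop (hR.comp (Primrec.fst.comp Primrec.fst))).to₂
  exact Primrec.list_map hR h.to₂

theorem Primrec.filter_range {p : α → ℕ → Prop} [∀ a, DecidablePred (p a)]
    (hp : PrimrecPred fun x : α × ℕ => p x.1 x.2) {g : α → ℕ} (hg : Primrec g) :
    Primrec fun a => (List.range (g a)).filter fun i => p a i := by
  have h : PrimrecRel fun (i : ℕ) (a : α) => p a i := hp.comp (Primrec.snd.pair Primrec.fst)
  exact h.listFilter.comp (Primrec.list_range.comp hg) Primrec.id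

/-- The `k`-th map from `{0, …, n - 1}` to itself, for `k < n ^ n`. -/
def nthMap (n k i : ℕ) : ℕ := k / n ^ i % n

theorem Primrec.nthMap {n k i : α → ℕ} (hn : Primrec n) (hk : Primrec k) (hi : Primrec i) :
    Primrec fun a => nthMap (n a) (k a) (i a) :=
  Primrec.nat_mod.comp (Primrec.nat_div.comp hk (Primrec.nat_pow.comp hn hi)) hn

/-- The values of `f` are the base `n` digits of `k`. -/
theorem exists_nthMap_eq {n : ℕ} (f : Fin n → Fin n) : ∃ k < n ^ n, ∀ i : Fin n,
    nthMap n k i = f i := by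
  refine ⟨finFunctionFinEquiv f, Fin.is_lt _, fun i => ?_⟩
  have := congrFun (finFunctionFinEquiv.symm_apply_apply f) i
  exact congrArg Fin.val this

/-- `t` is the multiplication table of a monoid. -/
def IsMonoidTable (t : List (List ℕ)) : Prop :=
  -- This clause forces a square table, so the default values in `tableOp` cannot hide ragged rows.
  t = opTable (tableOp t) (List.range t.length) ∧
  (∀ i < t.length, ∀ j < t.length, tableOp t i j < t.length) ∧
  (∀ i < t.length, ∀ j < t.length, ∀ k < t.length,
    tableOp t (tableOp t i j) k = tableOp t i (tableOp t j k)) ∧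
  ∃ i < t.length, ∀ j < t.length, tableOp t i j = j ∧ tableOp t j i = j

theorem computablePred_isMonoidTable : ComputablePred IsMonoidTable := by
  have hn : Primrec (List.length : List (List ℕ) → ℕ) := Primrec.list_length
  have h1 : Computable fun x : List (List ℕ) × ℕ => x.1.length :=
    (hn.comp Primrec.fst).to_comp
  have h2 : Computable fun x : (List (List ℕ) × ℕ) × ℕ => x.1.1.length := h1.comp Computable.fst
  have f1 : Primrec (fun x : List (List ℕ) × ℕ => x.1) := Primrec.fst
  have f2 : Primrec (fun x : (List (List ℕ) × ℕ) × ℕ => x.1.1) := f1.comp Primrec.fst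
  have f3 : Primrec (fun x : ((List (List ℕ) × ℕ) × ℕ) × ℕ => x.1.1.1) := f2.comp Primrec.fst
  have i2 : Primrec (fun x : (List (List ℕ) × ℕ) × ℕ => x.1.2) := Primrec.snd.comp Primrec.fst
  have i3 : Primrec (fun x : ((List (List ℕ) × ℕ) × ℕ) × ℕ => x.1.1.2) := i2.comp Primrec.fst
  have j3 : Primrec (fun x : ((List (List ℕ) × ℕ) × ℕ) × ℕ => x.1.2) := Primrec.snd.comp Primrec.fst
  refine ComputablePred.and_pred ?_ (ComputablePred.and_pred ?_ (ComputablePred.and_pred ?_ ?_))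
  · exact Computable.id.eq_pred
      (Primrec.opTable (f2.tableOp i2 Primrec.snd) (Primrec.list_range.comp hn)).to_comp
  · refine ComputablePred.forall_lt (ComputablePred.forall_lt ?_ h1) hn.to_comp
    exact (Primrec.nat_lt.comp (f2.tableOp i2 Primrec.snd) (hn.comp f2)).computablePred
  · refine ComputablePred.forall_lt (ComputablePred.forall_lt
      (ComputablePred.forall_lt ?_ h2) h1) hn.to_comp
    exact Computable.eq_pred (f3.tableOp (f3.tableOp i3 j3) Primrec.snd).to_comp
      (f3.tableOp i3 (f3.tableOp j3 Primrec.snd)).to_comp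
  · refine ComputablePred.exists_lt (ComputablePred.forall_lt (ComputablePred.and_pred ?_ ?_) h1)
      hn.to_comp
    · exact Computable.eq_pred (f2.tableOp i2 Primrec.snd).to_comp Computable.snd
    · exact Computable.eq_pred (f2.tableOp Primrec.snd i2).to_comp Computable.snd

/-- The members of `{0, …, n - 1}` fixed by `f`. -/
def fixedPoints (n : ℕ) (f : ℕ → ℕ) : List ℕ := (List.range n).filter fun i => f i = i

/-- The elements `i` of the local monoid of `t` at `e` with `f i = f e`. -/
def localKernel (t : List (List ℕ)) (f : ℕ → ℕ) (e : ℕ) : List ℕ :=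
  (List.range t.length).filter fun i => (tableOp t e i = i ∧ tableOp t i e = i) ∧ f i = f e

/-- Some congruence of the monoid with table `t`, given by a choice of representatives, has a
quotient with table satisfying `P` and local kernels with tables satisfying `K`. -/
def HasCongruence (K P : List (List ℕ) → Prop) (t : List (List ℕ)) : Prop :=
  ∃ k < t.length ^ t.length,
    (∀ i < t.length, nthMap t.length k (nthMap t.length k i) = nthMap t.length k i) ∧
    -- Compatibility of the representatives with products makes equality of representatives a
    -- congruence.
    (∀ i < t.length, ∀ j < t.length,
      nthMap t.length k (tableOp t (nthMap t.length k i) (nthMap t.length k j)) =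
        nthMap t.length k (tableOp t i j)) ∧
    P (opTable (fun i j => nthMap t.length k (tableOp t i j))
      (fixedPoints t.length (nthMap t.length k))) ∧
    ∀ e < t.length, tableOp t e e = e →
      K (opTable (tableOp t) (localKernel t (nthMap t.length k) e))

theorem ComputablePred.hasCongruence {K P : List (List ℕ) → Prop} (hK : ComputablePred K)
    (hP : ComputablePred P) : ComputablePred (HasCongruence K P) := by
  have hn : Primrec (List.length : List (List ℕ) → ℕ) := Primrec.list_length
  have f1 : Primrec (fun x : List (List ℕ) × ℕ => x.1) := Primrec.fst
  have f2 : Primrec (fun x : (List (List ℕ) × ℕ) × ℕ => x.1.1) := f1.comp Primrec.fst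
  have f3 : Primrec (fun x : ((List (List ℕ) × ℕ) × ℕ) × ℕ => x.1.1.1) := f2.comp Primrec.fst
  have f4 : Primrec (fun x : (((List (List ℕ) × ℕ) × ℕ) × ℕ) × ℕ => x.1.1.1.1) :=
    f3.comp Primrec.fst
  have i2 : Primrec (fun x : (List (List ℕ) × ℕ) × ℕ => x.1.2) := Primrec.snd.comp Primrec.fst
  have i3 : Primrec (fun x : ((List (List ℕ) × ℕ) × ℕ) × ℕ => x.1.1.2) := i2.comp Primrec.fst
  have j3 : Primrec (fun x : ((List (List ℕ) × ℕ) × ℕ) × ℕ => x.1.2) := Primrec.snd.comp Primrec.fst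
  have n1 := hn.comp f1
  have n2 := hn.comp f2
  have n3 := hn.comp f3
  refine ComputablePred.exists_lt (ComputablePred.and_pred ?_ (ComputablePred.and_pred ?_
    (ComputablePred.and_pred ?_ ?_))) (Primrec.nat_pow.comp hn hn).to_comp
  · refine ComputablePred.forall_lt ?_ n1.to_comp
    exact Computable.eq_pred (n2.nthMap i2 (n2.nthMap i2 Primrec.snd)).to_comp
      (n2.nthMap i2 Primrec.snd).to_comp
  · refine ComputablePred.forall_lt (ComputablePred.forall_lt ?_ n2.to_comp) n1.to_comp
    exact Computable.eq_pred
      (n3.nthMap i3 (f3.tableOp (n3.nthMap i3 j3) (n3.nthMap i3 Primrec.snd))).to_comp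
      (n3.nthMap i3 (f3.tableOp j3 Primrec.snd)).to_comp
  · refine hP.comp_computable (Primrec.opTable ?_ (Primrec.filter_range ?_ n1)).to_comp
    · exact n3.nthMap i3 (f3.tableOp j3 Primrec.snd)
    · exact Primrec.eq.comp (n2.nthMap i2 Primrec.snd) Primrec.snd
  · refine ComputablePred.forall_lt (ComputablePred.imp_pred ?_ (hK.comp_computable
      (Primrec.opTable ?_ (Primrec.filter_range ?_ n2)).to_comp)) n1.to_comp
    · exact Computable.eq_pred (f2.tableOp Primrec.snd Primrec.snd).to_comp Computable.snd
    · exact f4.tableOp (Primrec.snd.comp Primrec.fst) Primrec.snd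
    · exact ((Primrec.eq.comp (f3.tableOp j3 Primrec.snd) Primrec.snd).and
        (Primrec.eq.comp (f3.tableOp Primrec.snd j3) Primrec.snd)).and
        (Primrec.eq.comp (n3.nthMap i3 Primrec.snd) (n3.nthMap i3 j3))

end Computability

/-! ### Tables and the structures they determine -/

section Tables

/-- The position of the label `r x` in `R` numbers `X`. This serves whole monoids, quotients and
local kernels alike. -/
theorem exists_mulTable_eq_opTable {X : Type u} [Mul X] {op : ℕ → ℕ → ℕ} {R : List ℕ}
    (hR : R.Nodup) (r : X → ℕ) (hr : Function.Injective r) (hmem : ∀ i, i ∈ R ↔ ∃ x, r x = i)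
    (hop : ∀ x y, op (r x) (r y) = r (x * y)) :
    ∃ e : X ≃ Fin R.length, mulTable e = opTable op R := by
  have hrR : ∀ x, r x ∈ R := fun x => (hmem _).2 ⟨x, rfl⟩
  let e : X ≃ Fin R.length := Equiv.ofBijective
    (fun x => ⟨R.idxOf (r x), List.idxOf_lt_length_iff.2 (hrR x)⟩)
    ⟨fun x y h => hr ((List.idxOf_inj (hrR x)).1 (Fin.ext_iff.1 h)), fun i => by
      obtain ⟨x, hx⟩ := (hmem _).1 (List.getElem_mem i.2)
      exact ⟨x, Fin.ext (by simp only [hx]; exact hR.idxOf_getElem _ _)⟩⟩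
  have he : ∀ i : Fin R.length, r (e.symm i) = R[i] := fun i => by
    obtain ⟨x, rfl⟩ := e.surjective i
    rw [e.symm_apply_apply]
    exact (List.getElem_idxOf _).symm
  refine ⟨e, ?_⟩
  have he' : ∀ x, (e x : ℕ) = R.idxOf (r x) := fun _ => rfl
  refine List.ext_getElem (by simp [mulTable, opTable]) fun i hi hi' => ?_
  refine List.ext_getElem (by simp [mulTable, opTable]) fun j hj hj' => ?_
  simp [mulTable, opTable, he', ← hop, he]

theorem nonempty_mulEquiv_of_mulTable_eq {X Y : Type u} [Mul X] [Mul Y] {n m : ℕ}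
    {e : X ≃ Fin n} {e' : Y ≃ Fin m} (h : mulTable e = mulTable e') : Nonempty (X ≃* Y) := by
  obtain rfl : n = m := by simpa [mulTable] using congrArg List.length h
  refine ⟨⟨e.trans e'.symm, fun x y => ?_⟩⟩
  have h1 := congrFun (List.ofFn_injective (congrFun (List.ofFn_injective h) (e x))) (e y)
  simp only [Equiv.symm_apply_apply] at h1
  exact e'.injective (by simpa using Fin.ext h1)

@[simp] theorem length_mulTable {X : Type u} [Mul X] {n : ℕ} (e : X ≃ Fin n) :
    (mulTable e).length = n := by simp [mulTable]

theorem tableOp_mulTable {X : Type u} [Mul X] {n : ℕ} (e : X ≃ Fin n) (x y : X) :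
    tableOp (mulTable e) (e x) (e y) = e (x * y) := by
  simp [tableOp, mulTable]

theorem exists_mulTable_eq_iff {t : List (List ℕ)} :
    (∃ (M : Type u) (_ : Monoid M) (n : ℕ) (e : M ≃ Fin n), mulTable e = t) ↔
      IsMonoidTable t := by
  constructor
  · rintro ⟨M, _, n, e, rfl⟩
    have hs : ∀ i < n, ∃ x, (e x : ℕ) = i := fun i hi => ⟨e.symm ⟨i, hi⟩, by simp⟩
    refine ⟨?_, ?_, ?_, ?_⟩ <;> simp only [length_mulTable]
    · refine List.ext_getElem (by simp [opTable]) fun i hi hi' => ?_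
      refine List.ext_getElem (by simp [mulTable, opTable]) fun j hj hj' => ?_
      have hi : i < n := by simpa using hi
      have hjn : j < n := by simpa [mulTable] using hj
      obtain ⟨x, rfl⟩ := hs i hi
      obtain ⟨y, rfl⟩ := hs j hjn
      simp only [opTable, List.getElem_map, List.getElem_range, tableOp_mulTable]
      have : (List.range n).idxOf (e (x * y) : ℕ) = e (x * y) := by
        have h := List.nodup_range.idxOf_getElem (e (x * y) : ℕ)
          (by simp : _ < (List.range n).length)
        simpa using h
      rw [this]
      simp [mulTable]
    · intro i hi j hj
      obtain ⟨x, rfl⟩ := hs i hi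
      obtain ⟨y, rfl⟩ := hs j hj
      rw [tableOp_mulTable]
      exact Fin.is_lt _
    · intro i hi j hj k hk
      obtain ⟨x, rfl⟩ := hs i hi
      obtain ⟨y, rfl⟩ := hs j hj
      obtain ⟨z, rfl⟩ := hs k hk
      simp only [tableOp_mulTable, mul_assoc]
    · refine ⟨e 1, Fin.is_lt _, fun j hj => ?_⟩
      obtain ⟨y, rfl⟩ := hs j hj
      simp [tableOp_mulTable]
  · rintro ⟨h₁, h₂, h₃, i, hi, hu⟩
    -- The lift puts the carrier in the universe of the pseudovarieties.
    let I : Monoid (ULift.{u} (Fin t.length)) :=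
      { mul := fun a b => ⟨⟨tableOp t a.down b.down, h₂ _ a.down.2 _ b.down.2⟩⟩
        mul_assoc := fun a b c => ULift.ext _ _
          (Fin.ext (h₃ _ a.down.2 _ b.down.2 _ c.down.2))
        one := ⟨⟨i, hi⟩⟩
        one_mul := fun a => ULift.ext _ _ (Fin.ext (hu _ a.down.2).1)
        mul_one := fun a => ULift.ext _ _ (Fin.ext (hu _ a.down.2).2) }
    let _ : Mul (ULift.{u} (Fin t.length)) := I.toMul
    obtain ⟨e, he⟩ := exists_mulTable_eq_opTable (X := ULift.{u} (Fin t.length)) (op := tableOp t)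
      (R := List.range t.length) List.nodup_range (fun a => a.down)
      (fun a b h => ULift.ext _ _ (Fin.ext h))
      (fun i => by
        rw [List.mem_range]
        exact ⟨fun h => ⟨⟨⟨i, h⟩⟩, rfl⟩, by rintro ⟨a, rfl⟩; exact a.down.2⟩)
      (fun _ _ => rfl)
    exact ⟨_, _, _, e, he.trans h₁.symm⟩

end Tables

/-! ### Deciding membership by searching congruences -/

section Decidability

variable {M N : Type u} [Monoid M] [Monoid N]

/-- A table determines its monoid up to isomorphism, so the answer does not depend on the numbering.
-/
theorem MonoidPseudovariety.exists_mulTable_eq_iff_mem (V : MonoidPseudovariety.{u}) {n : ℕ}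
    (e : N ≃ Fin n) :
    (∃ (M : Type u) (_ : Monoid M) (m : ℕ) (e' : M ≃ Fin m), V.Mem M ∧ mulTable e' = mulTable e) ↔
      V.Mem N := by
  constructor
  · rintro ⟨M, _, m, e', hM, h⟩
    obtain ⟨σ⟩ := nonempty_mulEquiv_of_mulTable_eq h
    exact V.mem_of_surjective M N σ.toMonoidHom σ.surjective hM
  · exact fun h => ⟨N, _, n, e, h, rfl⟩

theorem GroupPseudovariety.exists_mulTable_eq_iff_exists_mulEquiv (H : GroupPseudovariety.{u})
    {n : ℕ} (e : N ≃ Fin n) :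
    (∃ (G : Type u) (_ : Group G) (m : ℕ) (e' : G ≃ Fin m), H.Mem G ∧ mulTable e' = mulTable e) ↔
      ∃ (G : Type u) (_ : Group G), H.Mem G ∧ Nonempty (G ≃* N) := by
  constructor
  · rintro ⟨G, _, m, e', hG, h⟩
    exact ⟨G, _, hG, nonempty_mulEquiv_of_mulTable_eq h⟩
  · rintro ⟨G, _, hG, ⟨σ⟩⟩
    exact ⟨G, _, n, σ.toEquiv.trans e, hG, by simp [mulTable]⟩

variable {n : ℕ} (e : M ≃ Fin n) (φ : M →* N) (σ : N → M) (hσ : ∀ x, φ (σ x) = x) (f : ℕ → ℕ)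
  (hf : ∀ a, f (e a) = e (σ (φ a)))

include hσ hf

/-- The fixed points of `f` are the numbers of the representatives `σ x`, one for each `x` in `N`.
-/
theorem exists_mulTable_eq_opTable_fixedPoints : ∃ (m : ℕ) (e' : N ≃ Fin m),
    mulTable e' = opTable (fun i j => f (tableOp (mulTable e) i j)) (fixedPoints n f) := by
  refine ⟨_, exists_mulTable_eq_opTable (R := fixedPoints n f) (List.nodup_range.filter _)
    (fun x => e (σ x)) ?_
    (fun i => ?_) (fun x y => ?_)⟩
  · exact fun x y h => (Function.LeftInverse.injective hσ) (e.injective (Fin.ext h))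
  · simp only [fixedPoints, List.mem_filter, List.mem_range, decide_eq_true_eq]
    constructor
    · rintro ⟨hi, hfi⟩
      refine ⟨φ (e.symm ⟨i, hi⟩), ?_⟩
      rw [← hf]
      simpa using hfi
    · rintro ⟨x, rfl⟩
      exact ⟨Fin.is_lt _, by rw [hf, hσ]⟩
  · simp only [tableOp_mulTable, hf, map_mul, hσ]

theorem exists_mulTable_eq_opTable_localKernel {a : M} (ha : IsIdempotentElem a) :
    ∃ (m : ℕ) (e' : MonoidHom.mker (LocalMonoid.map φ ha) ≃ Fin m),
      mulTable e' = opTable (tableOp (mulTable e)) (localKernel (mulTable e) f (e a)) := by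
  refine ⟨_, exists_mulTable_eq_opTable (R := localKernel (mulTable e) f (e a))
    (List.nodup_range.filter _) (fun s => e s.1.val) ?_
    (fun i => ?_) (fun x y => ?_)⟩
  · exact fun x y h => Subtype.ext (LocalMonoid.val_injective (e.injective (Fin.ext h)))
  · simp only [localKernel, List.mem_filter, List.mem_range, decide_eq_true_eq, length_mulTable]
    have key : ∀ b, ((tableOp (mulTable e) (e a) (e b) = e b ∧
        tableOp (mulTable e) (e b) (e a) = e b) ∧ f (e b) = f (e a)) ↔
        (a * b = b ∧ b * a = b) ∧ φ b = φ a := fun b => by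
      rw [tableOp_mulTable, tableOp_mulTable, hf, hf]
      simp only [← Fin.ext_iff, e.injective.eq_iff,
        (Function.LeftInverse.injective hσ).eq_iff]
    constructor
    · rintro ⟨hi, h⟩
      obtain ⟨b, hb⟩ := e.surjective ⟨i, hi⟩
      obtain rfl : (e b : ℕ) = i := by rw [hb]
      obtain ⟨⟨h₁, h₂⟩, h₃⟩ := (key b).1 h
      exact ⟨⟨LocalMonoid.ofMem ha b h₁ h₂, (LocalMonoid.map_eq_one_iff φ _).2 h₃⟩, rfl⟩
    · rintro ⟨s, rfl⟩
      exact ⟨Fin.is_lt _, (key _).2 ⟨⟨s.1.mul_val, s.1.val_mul⟩,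
        (LocalMonoid.map_eq_one_iff φ _).1 s.2⟩⟩
  · exact tableOp_mulTable e _ _

omit hσ hf

theorem hasCongruence_mulTable_iff (H : GroupPseudovariety.{u}) (V : MonoidPseudovariety.{u}) :
    HasCongruence
      (fun t => ∃ (G : Type u) (_ : Group G) (m : ℕ) (e' : G ≃ Fin m), H.Mem G ∧ mulTable e' = t)
      (fun t => ∃ (M : Type u) (_ : Monoid M) (m : ℕ) (e' : M ≃ Fin m), V.Mem M ∧ mulTable e' = t)
      (mulTable e) ↔
    ∃ (N : Type u) (_ : Monoid N), V.Mem N ∧ ∃ φ : M →* N, IsLHMorphism H φ := by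
  have hfin : Finite M := Finite.of_equiv _ e.symm
  -- Both directions reduce to a morphism with a section `σ`, where `f` is the numbered form of `σ ∘
  -- φ`.
  have key : ∀ (N : Type u) [Monoid N] (φ : M →* N) (σ : N → M) (_ : ∀ x, φ (σ x) = x) (f : ℕ → ℕ)
      (_ : ∀ a, f (e a) = e (σ (φ a))),
      ((∃ (M : Type u) (_ : Monoid M) (m : ℕ) (e' : M ≃ Fin m), V.Mem M ∧ mulTable e' =
        opTable (fun i j => f (tableOp (mulTable e) i j)) (fixedPoints n f)) ∧
      (∀ i < n, tableOp (mulTable e) i i = i → ∃ (G : Type u) (_ : Group G) (m : ℕ)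
        (e' : G ≃ Fin m), H.Mem G ∧ mulTable e' =
          opTable (tableOp (mulTable e)) (localKernel (mulTable e) f i))) ↔
      V.Mem N ∧ IsLHMorphism H φ := by
    intro N _ φ σ hσ f hf
    obtain ⟨m, e', he'⟩ := exists_mulTable_eq_opTable_fixedPoints e φ σ hσ f hf
    rw [← he', V.exists_mulTable_eq_iff_mem e', isLHMorphism_iff,
      and_iff_right (Function.LeftInverse.surjective hσ)]
    refine and_congr_right fun _ => ?_
    have hloc : ∀ (a : M) (ha : IsIdempotentElem a), (∃ (G : Type u) (_ : Group G) (m : ℕ)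
        (e' : G ≃ Fin m), H.Mem G ∧ mulTable e' =
          opTable (tableOp (mulTable e)) (localKernel (mulTable e) f (e a))) ↔ _ := fun a ha => by
      obtain ⟨m, e', he'⟩ := exists_mulTable_eq_opTable_localKernel e φ σ hσ f hf ha
      rw [← he', H.exists_mulTable_eq_iff_exists_mulEquiv e', exists_mulEquiv_mker_iff]
    constructor
    · intro h a ha
      exact (hloc a ha).1 (h (e a) (Fin.is_lt _) (by rw [tableOp_mulTable, ha.eq]))
    · intro h i hi hidem
      obtain ⟨a, ha⟩ := e.surjective ⟨i, hi⟩
      obtain rfl : (e a : ℕ) = i := by rw [ha]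
      rw [tableOp_mulTable] at hidem
      have ha : IsIdempotentElem a := e.injective (Fin.ext hidem)
      exact (hloc a ha).2 (h a ha)
  constructor
  · rintro ⟨k, -, hk⟩
    simp only [length_mulTable] at hk
    set f := nthMap n k with hf
    obtain ⟨h₁, h₂, h₃⟩ := hk
    -- The identity makes `n` positive, so reduction modulo `n` in `nthMap` gives values below `n`.
    have hn : 0 < n := (Nat.zero_le _).trans_lt (e 1).is_lt
    have hlt : ∀ i, f i < n := fun i => Nat.mod_lt _ hn
    let ρ : M → M := fun a => e.symm ⟨f (e a), hlt _⟩
    have hρ : ∀ a, (e (ρ a) : ℕ) = f (e a) := fun a => by simp [ρ]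
    have hmul : ∀ a b, f (e (ρ a * ρ b)) = f (e (a * b)) := fun a b => by
      rw [← tableOp_mulTable, ← tableOp_mulTable, hρ, hρ]
      exact h₂ _ (Fin.is_lt _) _ (Fin.is_lt _)
    let c : Con M :=
      { r := fun a b => ρ a = ρ b
        iseqv := ⟨fun _ => rfl, Eq.symm, Eq.trans⟩
        mul' := fun {a b c d} hab hcd => by
          refine e.injective (Fin.ext ?_)
          rw [hρ, hρ, ← hmul a c, ← hmul b d, hab, hcd] }
    have hρρ : ∀ a, ρ (ρ a) = ρ a := fun a => e.injective (Fin.ext (by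
      rw [hρ, hρ]; exact h₁ _ (Fin.is_lt _)))
    let σ : c.Quotient → M := fun q => Con.liftOn q ρ fun _ _ h => h
    have hσ : ∀ q, c.mk' (σ q) = q := fun q => by
      obtain ⟨a, rfl⟩ := Con.mk'_surjective q
      exact (Con.eq c).2 (hρρ a)
    obtain ⟨hV, hL⟩ := (key c.Quotient c.mk' σ hσ f fun a => (hρ a).symm).1 h₃
    exact ⟨_, _, hV, _, hL⟩
  · rintro ⟨N, _, hN, φ, hφ⟩
    choose σ hσ using hφ.1
    obtain ⟨k, hk, hkf⟩ := exists_nthMap_eq fun i => e (σ (φ (e.symm i)))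
    have hf : ∀ a, nthMap n k (e a) = e (σ (φ a)) := fun a => by rw [hkf]; simp
    have hs : ∀ i < n, ∃ x, (e x : ℕ) = i := fun i hi => ⟨e.symm ⟨i, hi⟩, by simp⟩
    refine ⟨k, by simpa using hk, ?_⟩
    simp only [length_mulTable]
    refine ⟨fun i hi => ?_, fun i hi j hj => ?_, (key N φ σ hσ _ hf).2 ⟨hN, hφ⟩⟩
    · obtain ⟨x, rfl⟩ := hs i hi
      rw [hf, hf, hσ]
    · obtain ⟨x, rfl⟩ := hs i hi
      obtain ⟨y, rfl⟩ := hs j hj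
      rw [hf, hf, tableOp_mulTable, tableOp_mulTable, hf, hf, map_mul, map_mul, hσ, hσ]

omit e

theorem isDecidable_malcevProduct {H : GroupPseudovariety.{u}} (hH : H.IsFitting)
    {V : MonoidPseudovariety.{u}} (hHd : H.IsDecidable) (hVd : V.IsDecidable) :
    (malcevProduct (fun S _ => H.LocallyMem S) V).IsDecidable := by
  refine (computablePred_isMonoidTable.and_pred
    (ComputablePred.hasCongruence hHd hVd)).of_eq fun t => ?_
  rw [← exists_mulTable_eq_iff.{u}]
  constructor
  · rintro ⟨⟨M, _, n, e, rfl⟩, h⟩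
    have hfin : Finite M := Finite.of_equiv _ e.symm
    exact ⟨M, _, n, e, (mem_malcevProduct_iff_exists_isLHMorphism V hH).2
      ((hasCongruence_mulTable_iff e H V).1 h), rfl⟩
  · rintro ⟨M, _, n, e, hM, rfl⟩
    have hfin : Finite M := Finite.of_equiv _ e.symm
    exact ⟨⟨M, _, n, e, rfl⟩, (hasCongruence_mulTable_iff e H V).2
      ((mem_malcevProduct_iff_exists_isLHMorphism V hH).1 hM)⟩

end Decidability

theorem mainTheorem4 (H : GroupPseudovariety.{u}) (hH : H.IsFitting)
    (V : MonoidPseudovariety.{u}) :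
    (∀ (M : Type u) [Monoid M] [Finite M],
      (malcevProduct (fun S _ => H.LocallyMem S) V).Mem M ↔
        ∃ (N : Type u) (_ : Monoid N), V.Mem N ∧ ∃ φ : M →* N, IsLHMorphism H φ) ∧
    (H.IsDecidable → V.IsDecidable →
      (malcevProduct (fun S _ => H.LocallyMem S) V).IsDecidable) :=
  ⟨fun _ _ _ => mem_malcevProduct_iff_exists_isLHMorphism V hH, isDecidable_malcevProduct hH⟩
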